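/- Let ${}_pF_q(a_1,\dots,a_p;b_1,\dots,b_q;z)=\sum_{k\ge 0}\frac{(a_1)_k\cdots(a_p)_k}{(b_1)_k\cdots(b_q)_k}\frac{z^k}{k!}$, where $(a)_0=1$ and $(a)_k=a(a+1)\cdots(a+k-1)$ for $k\ge 1$, extended by analytic continuation from $|z|<1$ to $\mathbb{C}\setminus[1,\infty)$ (principal branch). Let $n\ge 1$ be an integer. For even $m\ge 0$ and real $x$ with $0<|x|<1$, consider the identity $$\sum_{k=1}^\infty\frac{(2x)^{2k}}{\binom{2k}{k}k(2k+m)}=\frac{\binom{m}{m/2}}{(2x)^{m}}\Bigl(\arcsin^2 x-\sqrt{1-x^2}\,\arcsin x\sum_{j=0}^{(m-2)/2}\frac{(2x)^{2j+1}}{\binom{2j}{j}(2j+1)}+\frac12\sum_{j=1}^{m/2}\frac{(2x)^{2j}}{\binom{2j}{j}j^2}\Bigr),\qquad(\mathrm{A}_m)$$ where for $m=0$ the two finite sums are empty, and for complex $z$ with $|z|<1$ the identity $$(2n-1)\,{}_3F_2(1,1,n;\tfrac32,n+1;z)+{}_3F_2(1,n,n;n+\tfrac12,n+1;z)=2n\,{}_2F_1\bigl(\tfrac12,1;\tfrac32;\tfrac{z}{z-1}\bigr)\,{}_2F_1(1,n;n+\tfrac12;z).\qquad(\mathrm{H}_n)$$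 Then for every real $x$ with $0<|x|<1$, identity $(\mathrm{A}_{2(n-1)})$ at $x$ is equivalent to identity $(\mathrm{H}_n)$ at $z=x^2$. Moreover, both identities are valid: $(\mathrm{A}_{2(n-1)})$ holds for all real $x$ with $0<|x|<1$, and $(\mathrm{H}_n)$ holds for all complex $z$ with $|z|<1$. -/

import Mathlib

/-- The `k`-th term `(a₁)ₖ ⋯ (aₚ)ₖ / ((b₁)ₖ ⋯ (b_q)ₖ) · zᵏ / k!` of the generalized hypergeometric
series with upper parameters `a = [a₁, …, aₚ]` and lower parameters `b = [b₁, …, b_q]`, where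
`(c)ₖ = c (c + 1) ⋯ (c + k - 1)` is the Pochhammer symbol. -/
noncomputable def hypTerm (a b : List ℂ) (z : ℂ) (k : ℕ) : ℂ :=
  (a.map fun c => (ascPochhammer ℂ k).eval c).prod /
    (b.map fun c => (ascPochhammer ℂ k).eval c).prod * (z ^ k / (Nat.factorial k : ℂ))

/-- The complex plane cut along `[1, ∞)`. -/
def cutPlane : Set ℂ := {z | 1 - z ∈ Complex.slitPlane}

/-- `F` is the principal branch of the hypergeometric function with parameters `a`, `b`: it is
holomorphic on `ℂ ∖ [1, ∞)` and is the sum of the hypergeometric series in the unit disc. -/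
def IsHypBranch (a b : List ℂ) (F : ℂ → ℂ) : Prop :=
  DifferentiableOn ℂ F cutPlane ∧ ∀ z : ℂ, ‖z‖ < 1 → HasSum (hypTerm a b z) (F z)

open Classical in
/-- The generalized hypergeometric function `pFq(a; b; z)`: the sum of the hypergeometric series,
analytically continued from the unit disc to `ℂ ∖ [1, ∞)` (principal branch). The continuation is
unique, see `IsHypBranch.eqOn`. -/
noncomputable def hypPFQ (a b : List ℂ) (z : ℂ) : ℂ :=
  if h : z ∈ cutPlane ∧ ∃ F : ℂ → ℂ, IsHypBranch a b F then h.2.choose z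
  else ∑' k : ℕ, hypTerm a b z k

theorem mem_cutPlane_of_norm_lt_one {z : ℂ} (hz : ‖z‖ < 1) : z ∈ cutPlane := by
  have h1 : z.re ≤ ‖z‖ := Complex.re_le_norm z
  refine Or.inl ?_
  simp only [Complex.sub_re, Complex.one_re]
  linarith

theorem IsHypBranch.eqOn {a b : List ℂ} {F G : ℂ → ℂ} (hF : IsHypBranch a b F)
    (hG : IsHypBranch a b G) : Set.EqOn F G cutPlane := by
  have hopen : IsOpen cutPlane :=
    Complex.isOpen_slitPlane.preimage (continuous_const.sub continuous_id)
  have hconn : IsPreconnected cutPlane := by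
    have h1 : cutPlane = (fun w : ℂ => 1 - w) '' Complex.slitPlane := by
      ext z
      constructor
      · intro hz
        exact ⟨1 - z, hz, by ring⟩
      · rintro ⟨w, hw, rfl⟩
        simpa [cutPlane] using hw
    rw [h1]
    refine IsPreconnected.image ?_ _ (by fun_prop)
    exact (Complex.starConvex_one_slitPlane.isPathConnected
      Complex.one_mem_slitPlane).isConnected.isPreconnected
  refine (hF.1.analyticOnNhd hopen).eqOn_of_preconnected_of_eventuallyEq
    (hG.1.analyticOnNhd hopen) hconn (mem_cutPlane_of_norm_lt_one (z := 0) (by simp)) ?_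
  filter_upwards [Metric.ball_mem_nhds (0 : ℂ) one_pos] with z hz
  have hz' : ‖z‖ < 1 := by simpa using hz
  exact (hF.2 z hz').unique (hG.2 z hz')

theorem IsHypBranch.hypPFQ_eq {a b : List ℂ} {F : ℂ → ℂ} (hF : IsHypBranch a b F) {z : ℂ}
    (hz : z ∈ cutPlane) : hypPFQ a b z = F z := by
  have h : z ∈ cutPlane ∧ ∃ F : ℂ → ℂ, IsHypBranch a b F := ⟨hz, F, hF⟩
  rw [hypPFQ, dif_pos h]
  exact h.2.choose_spec.eqOn hF hz

/-- In the unit disc, `hypPFQ` is the sum of the hypergeometric series. -/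
theorem hypPFQ_eq_tsum (a b : List ℂ) {z : ℂ} (hz : ‖z‖ < 1) :
    hypPFQ a b z = ∑' k : ℕ, hypTerm a b z k := by
  by_cases h : z ∈ cutPlane ∧ ∃ F : ℂ → ℂ, IsHypBranch a b F
  · rw [hypPFQ, dif_pos h]
    exact (h.2.choose_spec.2 z hz).tsum_eq.symm
  · rw [hypPFQ, dif_neg h]

/-- The arcsine identity at `x`, for even `m ≥ 0` (the series on the left, summed over `k + 1`
with `k ≥ 0`, converges to the right-hand side):
`∑_{k ≥ 1} (2x)^(2k) / (C(2k,k) k (2k+m)) = C(m, m/2) / (2x)^m * (arcsin² x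
  - √(1-x²) arcsin x ∑_{j=0}^{(m-2)/2} (2x)^(2j+1) / (C(2j,j) (2j+1))
  + 1/2 ∑_{j=1}^{m/2} (2x)^(2j) / (C(2j,j) j²))`. -/
def ArcsinSqIdentity (m : ℕ) (x : ℝ) : Prop :=
  HasSum
    (fun k : ℕ => (2 * x) ^ (2 * (k + 1)) /
      (((2 * (k + 1)).choose (k + 1) : ℝ) * ((k : ℝ) + 1) * (2 * ((k : ℝ) + 1) + (m : ℝ))))
    ((m.choose (m / 2) : ℝ) / (2 * x) ^ m *
      (Real.arcsin x ^ 2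
        - √(1 - x ^ 2) * Real.arcsin x *
          ∑ j ∈ Finset.range (m / 2),
            (2 * x) ^ (2 * j + 1) / (((2 * j).choose j : ℝ) * (2 * (j : ℝ) + 1))
        + 1 / 2 * ∑ j ∈ Finset.Icc 1 (m / 2),
            (2 * x) ^ (2 * j) / (((2 * j).choose j : ℝ) * (j : ℝ) ^ 2)))

/-- The hypergeometric identity at `z`:
`(2n-1) ₃F₂(1,1,n; 3/2,n+1; z) + ₃F₂(1,n,n; n+1/2,n+1; z)
  = 2n ₂F₁(1/2,1; 3/2; z/(z-1)) ₂F₁(1,n; n+1/2; z)`. -/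
def HypProductIdentity (n : ℕ) (z : ℂ) : Prop :=
  (2 * (n : ℂ) - 1) * hypPFQ [1, 1, (n : ℂ)] [3 / 2, (n : ℂ) + 1] z
      + hypPFQ [1, (n : ℂ), (n : ℂ)] [(n : ℂ) + 1 / 2, (n : ℂ) + 1] z
    = 2 * (n : ℂ) * hypPFQ [1 / 2, 1] [3 / 2] (z / (z - 1)) *
        hypPFQ [1, (n : ℂ)] [(n : ℂ) + 1 / 2] z

/-! Write `r n k = pochRatio n k`, `G = ∑ r 1 k zᵏ`, `L = ∑ r n k zᵏ`, and let `A`, `B` be `G`, `L`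
with `k`-th term weighted by `n / (n + k)`. Pfaff's transformation turns the `₂F₁` at `z / (z - 1)`
into `(1 - z) G`, so (H_n) reads `(2n - 1) A + B = 2n (1 - z) G L`.

This holds formally (`pochRatio_mk_product`): `n + X d/dX` removes the weights, and the first-order
equations of `G` and `L` show that it kills the difference of the two sides. It multiplies the
`k`-th coefficient by `n + k ≠ 0`, so the difference is zero.

For the equivalence at `z = x²`, (A_{2(n-1)}) says that `A` equals `n / x²` times its right-hand
side. That closed form, put in place of `A`, satisfies the same linear equation
(`arcsinSqRHS_add_tsum`): `L` and `B` are rescaled tails of `G` and of the weighted series for `n =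
1`, whose sums involve `arcsin x` and `arcsin² x`. As `2n - 1 ≠ 0`, the two identities are
equivalent. -/

/-! ### Pochhammer ratios and central binomial coefficients -/

/-- The ratio `(n)ₖ / (n + 1/2)ₖ` of Pochhammer symbols. -/
noncomputable def pochRatio (n k : ℕ) : ℂ :=
  (ascPochhammer ℂ k).eval (n : ℂ) / (ascPochhammer ℂ k).eval ((n : ℂ) + 1 / 2)

theorem natCast_add_half_ne_zero (n : ℕ) : (n : ℂ) + 1 / 2 ≠ 0 := by
  intro h
  have h1 := congrArg Complex.re h
  simp at h1
  have : (0 : ℝ) ≤ n := n.cast_nonneg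
  linarith

theorem pochRatio_zero (n : ℕ) : pochRatio n 0 = 1 := by simp [pochRatio]

theorem pochRatio_succ (n k : ℕ) :
    pochRatio n (k + 1) = pochRatio n k * (((n + k : ℕ) : ℂ) / (((n + k : ℕ) : ℂ) + 1 / 2)) := by
  simp only [pochRatio, ascPochhammer_succ_eval]
  rw [mul_div_mul_comm]
  push_cast
  ring_nf

theorem pochRatio_succ_mul (n k : ℕ) :
    pochRatio n (k + 1) * ((n : ℂ) + k + 1 / 2) = pochRatio n k * ((n : ℂ) + k) := by
  have h := natCast_add_half_ne_zero (n + k)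
  rw [pochRatio_succ, mul_assoc]
  push_cast at h ⊢
  rw [div_mul_cancel₀ _ h]

theorem norm_pochRatio_le_one (n k : ℕ) : ‖pochRatio n k‖ ≤ 1 := by
  induction k with
  | zero => simp [pochRatio_zero]
  | succ k ih =>
    rw [pochRatio_succ, norm_mul]
    refine mul_le_one₀ ih (norm_nonneg _) ?_
    have h : ((((n + k : ℕ) : ℂ) / (((n + k : ℕ) : ℂ) + 1 / 2)) : ℂ)
        = (((n + k : ℕ) : ℝ) / (((n + k : ℕ) : ℝ) + 1 / 2) : ℝ) := by push_cast; rfl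
    have h0 : (0 : ℝ) ≤ ((n + k : ℕ) : ℝ) := Nat.cast_nonneg _
    rw [h, Complex.norm_real, Real.norm_of_nonneg (by positivity)]
    rw [div_le_one (by positivity)]
    linarith

theorem pochRatio_add (n p k : ℕ) :
    pochRatio n (p + k) = pochRatio n p * pochRatio (n + p) k := by
  induction k with
  | zero => simp [pochRatio_zero]
  | succ k ih => rw [← add_assoc, pochRatio_succ, ih, pochRatio_succ, mul_assoc, add_assoc n p k]

theorem pochRatio_one_eq (k : ℕ) :
    pochRatio 1 k = 4 ^ k / (((2 * k).choose k : ℂ) * (2 * k + 1)) := by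
  have hodd : ∀ k : ℕ, (2 * (k : ℂ) + 1) ≠ 0 := fun k => by exact_mod_cast Nat.succ_ne_zero (2 * k)
  induction k with
  | zero => simp [pochRatio_zero]
  | succ k ih =>
    have h1 := natCast_add_half_ne_zero (1 + k)
    have h2 := hodd k
    have h3 := hodd (k + 1)
    have h4 : ((2 * k).choose k : ℂ) ≠ 0 := by exact_mod_cast k.centralBinom_ne_zero
    have h5 : ((2 * (k + 1)).choose (k + 1) : ℂ) ≠ 0 := by
      exact_mod_cast (k + 1).centralBinom_ne_zero
    have h6 : ((k : ℂ) + 1) * ((2 * (k + 1)).choose (k + 1) : ℂ)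
        = 2 * (2 * k + 1) * ((2 * k).choose k : ℂ) := by
      exact_mod_cast Nat.succ_mul_centralBinom_succ k
    rw [pochRatio_succ, ih]
    push_cast at h1 h3 ⊢
    rw [div_mul_div_comm, div_eq_div_iff (mul_ne_zero (mul_ne_zero h4 h2) h1) (mul_ne_zero h5 h3)]
    linear_combination (4 ^ k * (2 * (k : ℂ) + 3)) * h6

/-- The index-shifted form, matching the sums over `k ≥ 1` in the arcsine identity. -/
theorem pochRatio_one_eq' (k : ℕ) :
    pochRatio 1 k = 4 ^ (k + 1) / (2 * (((2 * (k + 1)).choose (k + 1) : ℂ) * (k + 1))) := by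
  have h2 : (2 * (k : ℂ) + 1) ≠ 0 := by exact_mod_cast Nat.succ_ne_zero (2 * k)
  have h3 : ((k : ℂ) + 1) ≠ 0 := Nat.cast_add_one_ne_zero k
  have h4 : ((2 * k).choose k : ℂ) ≠ 0 := by exact_mod_cast k.centralBinom_ne_zero
  have h5 : ((2 * (k + 1)).choose (k + 1) : ℂ) ≠ 0 := by
    exact_mod_cast (k + 1).centralBinom_ne_zero
  have h6 : ((k : ℂ) + 1) * ((2 * (k + 1)).choose (k + 1) : ℂ)
      = 2 * (2 * k + 1) * ((2 * k).choose k : ℂ) := by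
    exact_mod_cast Nat.succ_mul_centralBinom_succ k
  rw [pochRatio_one_eq, div_eq_div_iff (mul_ne_zero h4 h2)
    (mul_ne_zero two_ne_zero (mul_ne_zero h5 h3))]
  linear_combination (2 * 4 ^ k) * h6

theorem ascPochhammer_eval_add_one (c : ℂ) (k : ℕ) :
    (ascPochhammer ℂ k).eval c * (c + k) = c * (ascPochhammer ℂ k).eval (c + 1) := by
  rw [← ascPochhammer_succ_eval, ascPochhammer_succ_left]
  simp

theorem ascPochhammer_eval_natCast_ne_zero {n : ℕ} (hn : 1 ≤ n) (k : ℕ) :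
    (ascPochhammer ℂ k).eval (n : ℂ) ≠ 0 := by
  obtain ⟨p, rfl⟩ := Nat.exists_eq_add_of_le' hn
  rw [ascPochhammer_nat_eq_natCast_ascFactorial]
  exact_mod_cast (Nat.ascFactorial_pos p k).ne'

theorem ascPochhammer_eval_div_succ {n : ℕ} (hn : 1 ≤ n) (k : ℕ) :
    (ascPochhammer ℂ k).eval (n : ℂ) / (ascPochhammer ℂ k).eval ((n : ℂ) + 1)
      = n / ((n : ℂ) + k) := by
  have h0 : (ascPochhammer ℂ k).eval ((n : ℂ) + 1) ≠ 0 := by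
    exact_mod_cast ascPochhammer_eval_natCast_ne_zero (n := n + 1) (by omega) k
  have h1 : (n : ℂ) + k ≠ 0 := by exact_mod_cast (by omega : n + k ≠ 0)
  rw [div_eq_div_iff h0 h1]
  exact ascPochhammer_eval_add_one _ k

/-! ### Terms of the four hypergeometric series -/

theorem hypTerm_one_one {n : ℕ} (hn : 1 ≤ n) (z : ℂ) (k : ℕ) :
    hypTerm [1, 1, (n : ℂ)] [3 / 2, (n : ℂ) + 1] z k
      = pochRatio 1 k * (n / ((n : ℂ) + k)) * z ^ k := by
  have h : (3 / 2 : ℂ) = ((1 : ℕ) : ℂ) + 1 / 2 := by norm_num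
  have hk : (k.factorial : ℂ) ≠ 0 := by exact_mod_cast k.factorial_ne_zero
  rw [← ascPochhammer_eval_div_succ hn, pochRatio, ← h]
  simp only [hypTerm, List.map_cons, List.map_nil, List.prod_cons, List.prod_nil,
    ascPochhammer_eval_one, mul_one, Nat.cast_one]
  field_simp

theorem hypTerm_one_nat_nat {n : ℕ} (hn : 1 ≤ n) (z : ℂ) (k : ℕ) :
    hypTerm [1, (n : ℂ), (n : ℂ)] [(n : ℂ) + 1 / 2, (n : ℂ) + 1] z k
      = pochRatio n k * (n / ((n : ℂ) + k)) * z ^ k := by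
  have hk : (k.factorial : ℂ) ≠ 0 := by exact_mod_cast k.factorial_ne_zero
  rw [← ascPochhammer_eval_div_succ hn, pochRatio]
  simp only [hypTerm, List.map_cons, List.map_nil, List.prod_cons, List.prod_nil,
    ascPochhammer_eval_one, mul_one]
  field_simp

theorem hypTerm_one_nat (n : ℕ) (z : ℂ) (k : ℕ) :
    hypTerm [1, (n : ℂ)] [(n : ℂ) + 1 / 2] z k = pochRatio n k * z ^ k := by
  have hk : (k.factorial : ℂ) ≠ 0 := by exact_mod_cast k.factorial_ne_zero
  rw [pochRatio]
  simp only [hypTerm, List.map_cons, List.map_nil, List.prod_cons, List.prod_nil,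
    ascPochhammer_eval_one, mul_one]
  field_simp

theorem hypTerm_half_one (z : ℂ) (k : ℕ) :
    hypTerm [1 / 2, 1] [3 / 2] z k = z ^ k * (1 / (2 * (k : ℂ) + 1)) := by
  have hk : (k.factorial : ℂ) ≠ 0 := by exact_mod_cast k.factorial_ne_zero
  have h2 : (2 * (k : ℂ) + 1) ≠ 0 := by exact_mod_cast Nat.succ_ne_zero (2 * k)
  have h := ascPochhammer_eval_add_one (1 / 2) k
  have h32 : (1 / 2 + 1 : ℂ) = 3 / 2 := by norm_num
  rw [h32] at h
  have h0 : ∀ k : ℕ, (ascPochhammer ℂ k).eval (3 / 2 : ℂ) ≠ 0 := by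
    intro k
    induction k with
    | zero => simp
    | succ k ih =>
      rw [ascPochhammer_succ_eval]
      refine mul_ne_zero ih ?_
      have := natCast_add_half_ne_zero (k + 1)
      push_cast at this
      intro h
      exact this (by linear_combination h)
  have h0 := h0 k
  simp only [hypTerm, List.map_cons, List.map_nil, List.prod_cons, List.prod_nil,
    ascPochhammer_eval_one, mul_one]
  field_simp
  linear_combination (2 * z ^ k) * h

/-! ### Euler integrals, Pfaff's transformation and the arcsine -/

open intervalIntegral in
-- Geometric series integrated termwise. It is used with `φ = t²` and with `φ = 1 - t²`, the two
-- sides of Pfaff's transformation.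
theorem hasSum_integral_inv_one_sub {φ : ℝ → ℝ} (hφ : Continuous φ)
    (h0 : ∀ t ∈ Set.Icc (0 : ℝ) 1, 0 ≤ φ t) (h1 : ∀ t ∈ Set.Icc (0 : ℝ) 1, φ t ≤ 1)
    {w : ℂ} (hw : ‖w‖ < 1) :
    HasSum (fun k : ℕ => w ^ k * ((∫ t in (0 : ℝ)..1, φ t ^ k : ℝ) : ℂ))
      (∫ t in (0 : ℝ)..1, (1 - w * (φ t : ℂ))⁻¹) := by
  have hmem : ∀ t ∈ Set.uIoc (0 : ℝ) 1, ‖w * (φ t : ℂ)‖ ≤ ‖w‖ := by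
    intro t ht
    rw [Set.uIoc_of_le zero_le_one] at ht
    have ht' := Set.Ioc_subset_Icc_self ht
    rw [norm_mul, Complex.norm_real, Real.norm_of_nonneg (h0 t ht')]
    exact mul_le_of_le_one_right (norm_nonneg _) (h1 t ht')
  have key : HasSum (fun k : ℕ => ∫ t in (0 : ℝ)..1, (w * (φ t : ℂ)) ^ k)
      (∫ t in (0 : ℝ)..1, (1 - w * (φ t : ℂ))⁻¹) := by
    refine hasSum_integral_of_dominated_convergence (fun k _ => ‖w‖ ^ k) ?_ ?_ ?_ ?_ ?_
    · intro k
      exact Continuous.aestronglyMeasurable (by fun_prop)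
    · intro k
      refine Filter.Eventually.of_forall fun t ht => ?_
      rw [norm_pow]
      exact pow_le_pow_left₀ (norm_nonneg _) (hmem t ht) k
    · exact Filter.Eventually.of_forall fun t _ =>
        summable_geometric_of_lt_one (norm_nonneg _) hw
    · exact intervalIntegrable_const
    · exact Filter.Eventually.of_forall fun t ht =>
        hasSum_geometric_of_norm_lt_one ((hmem t ht).trans_lt hw)
  convert key using 2 with k
  rw [← integral_ofReal, ← integral_const_mul]
  congr 1
  ext t
  push_cast
  ring

theorem one_sub_mul_sq_ne_zero {w : ℂ} (hw : w ∈ cutPlane) {t : ℝ} (ht : t ∈ Set.Icc (0 : ℝ) 1) :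
    1 - w * (t : ℂ) ^ 2 ≠ 0 := by
  have h : 1 - w * (t : ℂ) ^ 2 ∈ Complex.slitPlane := by
    -- `1 - w t²` lies on the segment from `1` to `1 - w`.
    have := Complex.starConvex_one_slitPlane hw (a := 1 - t ^ 2) (b := t ^ 2)
      (by nlinarith [ht.1, ht.2]) (by positivity) (by ring)
    convert this using 1
    simp only [Complex.real_smul]
    push_cast
    ring
  exact Complex.slitPlane_ne_zero h

/-- Euler's integral for `₂F₁(1/2, 1; 3/2; w)`. -/
noncomputable def eulerIntegral (w : ℂ) : ℂ := ∫ t in (0 : ℝ)..1, (1 - w * ((t ^ 2 : ℝ) : ℂ))⁻¹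

theorem isOpen_cutPlane : IsOpen cutPlane :=
  Complex.isOpen_slitPlane.preimage (continuous_const.sub continuous_id)

theorem differentiableOn_eulerIntegral : DifferentiableOn ℂ eulerIntegral cutPlane := by
  intro w₀ hw₀
  obtain ⟨ε, hε, hball⟩ := Metric.nhds_basis_closedBall.mem_iff.1 (isOpen_cutPlane.mem_nhds hw₀)
  have hne : ∀ w ∈ Metric.closedBall w₀ ε, ∀ t ∈ Set.Icc (0 : ℝ) 1,
      1 - w * ((t ^ 2 : ℝ) : ℂ) ≠ 0 := by
    intro w hw t ht
    push_cast
    exact one_sub_mul_sq_ne_zero (hball hw) ht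
  have hIoc : ∀ t ∈ Set.uIoc (0 : ℝ) 1, t ∈ Set.Icc (0 : ℝ) 1 := by
    intro t ht
    rw [Set.uIoc_of_le zero_le_one] at ht
    exact Set.Ioc_subset_Icc_self ht
  have hIcc : Set.uIcc (0 : ℝ) 1 = Set.Icc 0 1 := Set.uIcc_of_le zero_le_one
  have hcont : ∀ w ∈ Metric.closedBall w₀ ε,
      ContinuousOn (fun t : ℝ => (1 - w * ((t ^ 2 : ℝ) : ℂ))⁻¹) (Set.Icc 0 1) := by
    intro w hw
    exact ContinuousOn.inv₀ (by fun_prop) (hne w hw)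
  have hcont' : ContinuousOn
      (fun p : ℂ × ℝ => ((p.2 ^ 2 : ℝ) : ℂ) / (1 - p.1 * ((p.2 ^ 2 : ℝ) : ℂ)) ^ 2)
      (Metric.closedBall w₀ ε ×ˢ Set.Icc (0 : ℝ) 1) := by
    refine ContinuousOn.div (by fun_prop) (by fun_prop) ?_
    rintro ⟨w, t⟩ ⟨hw, ht⟩
    exact pow_ne_zero 2 (hne w hw t ht)
  obtain ⟨C, hC⟩ := ((isCompact_closedBall w₀ ε).prod isCompact_Icc).exists_bound_of_continuousOn
    hcont'
  have hself : w₀ ∈ Metric.closedBall w₀ ε := Metric.mem_closedBall_self hε.le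
  have hmeas : ∀ f : ℝ → ℂ, ContinuousOn f (Set.Icc 0 1) → MeasureTheory.AEStronglyMeasurable f
      (MeasureTheory.volume.restrict (Set.uIoc (0 : ℝ) 1)) := by
    intro f hf
    exact (hf.mono hIoc).aestronglyMeasurable measurableSet_uIoc
  refine (intervalIntegral.hasDerivAt_integral_of_dominated_loc_of_deriv_le
    (F := fun w (t : ℝ) => (1 - w * ((t ^ 2 : ℝ) : ℂ))⁻¹)
    (F' := fun w (t : ℝ) => ((t ^ 2 : ℝ) : ℂ) / (1 - w * ((t ^ 2 : ℝ) : ℂ)) ^ 2)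
    (bound := fun _ => C) (Metric.closedBall_mem_nhds w₀ hε) ?_ ?_ ?_ ?_ ?_ ?_).2
    |>.differentiableAt.differentiableWithinAt
  · filter_upwards [Metric.closedBall_mem_nhds w₀ hε] with w hw
    exact hmeas _ (hcont w hw)
  · exact ContinuousOn.intervalIntegrable (by rw [hIcc]; exact hcont w₀ hself)
  · refine hmeas _ (hcont'.comp (f := fun t : ℝ => (w₀, t)) (by fun_prop) ?_)
    exact fun t ht => ⟨hself, ht⟩
  · exact Filter.Eventually.of_forall fun t ht w hw => hC (w, t) ⟨hw, hIoc t ht⟩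
  · exact intervalIntegrable_const
  · refine Filter.Eventually.of_forall fun t ht w hw => ?_
    have h := (((hasDerivAt_id w).mul_const ((t ^ 2 : ℝ) : ℂ)).const_sub 1).inv
      (hne w hw t (hIoc t ht))
    exact h.congr_deriv (by simp)

/-- Needed because `z / (z - 1)` can leave the unit disc when `‖z‖ < 1`, so the series alone does
not give the value there. -/
theorem isHypBranch_eulerIntegral : IsHypBranch [1 / 2, 1] [3 / 2] eulerIntegral := by
  refine ⟨differentiableOn_eulerIntegral, fun w hw => ?_⟩
  have h := hasSum_integral_inv_one_sub (φ := fun t => t ^ 2) (by fun_prop)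
    (fun t _ => by positivity) (fun t ht => by nlinarith [ht.1, ht.2]) hw
  refine h.congr_fun fun k => ?_
  rw [hypTerm_half_one]
  simp [← pow_mul, integral_pow]

theorem integral_one_sub_sq_pow (k : ℕ) :
    ((∫ t in (0 : ℝ)..1, (1 - t ^ 2) ^ k : ℝ) : ℂ) = pochRatio 1 k := by
  induction k with
  | zero => simp [pochRatio_zero]
  | succ k ih =>
    -- This primitive vanishes at both endpoints, which gives the Wallis recurrence between
    -- consecutive integrals.
    have hd : ∀ t ∈ Set.uIcc (0 : ℝ) 1, HasDerivAt (fun t : ℝ => t * (1 - t ^ 2) ^ (k + 1))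
        ((2 * k + 3) * (1 - t ^ 2) ^ (k + 1) - (2 * k + 2) * (1 - t ^ 2) ^ k) t := by
      intro t _
      have h := (hasDerivAt_id t).mul ((((hasDerivAt_id t).pow 2).const_sub 1).pow (k + 1))
      refine h.congr_deriv ?_
      simp
      ring
    have h := intervalIntegral.integral_eq_sub_of_hasDerivAt hd
      (Continuous.intervalIntegrable (by fun_prop) _ _)
    rw [intervalIntegral.integral_sub (Continuous.intervalIntegrable (by fun_prop) _ _)
      (Continuous.intervalIntegrable (by fun_prop) _ _), intervalIntegral.integral_const_mul,
      intervalIntegral.integral_const_mul] at h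
    have h' := congrArg (fun r : ℝ => (r : ℂ)) h
    have h3 := pochRatio_succ_mul 1 k
    have h4 := natCast_add_half_ne_zero (k + 1)
    refine mul_right_cancel₀ h4 ?_
    simp only [Complex.ofReal_sub, Complex.ofReal_mul, ih] at h'
    push_cast at h' h3 ⊢
    simp at h'
    linear_combination (1 / 2 : ℂ) * h' - h3

theorem hasSum_pochRatio_one {z : ℂ} (hz : ‖z‖ < 1) :
    HasSum (fun k => pochRatio 1 k * z ^ k)
      (∫ t in (0 : ℝ)..1, (1 - z * ((1 - t ^ 2 : ℝ) : ℂ))⁻¹) := by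
  have h := hasSum_integral_inv_one_sub (φ := fun t => 1 - t ^ 2) (by fun_prop)
    (fun t ht => by nlinarith [ht.1, ht.2]) (fun t _ => by nlinarith [sq_nonneg t]) hz
  convert h using 2 with k
  rw [integral_one_sub_sq_pow, mul_comm]

theorem div_sub_one_mem_cutPlane {z : ℂ} (hz : ‖z‖ < 1) : z / (z - 1) ∈ cutPlane := by
  have h1 : (1 : ℂ) - z ∈ Complex.slitPlane := mem_cutPlane_of_norm_lt_one hz
  have h2 := Complex.slitPlane_ne_zero h1
  have h3 : 1 - z / (z - 1) = (1 - z)⁻¹ := by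
    have : z - 1 ≠ 0 := fun h => h2 (by linear_combination -h)
    field_simp
    ring
  change 1 - z / (z - 1) ∈ Complex.slitPlane
  rw [h3]
  refine Or.inl ?_
  rw [Complex.inv_re]
  refine div_pos ?_ (Complex.normSq_pos.2 h2)
  rw [Complex.sub_re, Complex.one_re]
  linarith [Complex.re_le_norm z]

/-- Pfaff's transformation of `₂F₁(1/2, 1; 3/2; z / (z - 1))`. -/
theorem hypPFQ_half_one_div_sub_one {z : ℂ} (hz : ‖z‖ < 1) :
    hypPFQ [1 / 2, 1] [3 / 2] (z / (z - 1)) = (1 - z) * ∑' k, pochRatio 1 k * z ^ k := by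
  rw [isHypBranch_eulerIntegral.hypPFQ_eq (div_sub_one_mem_cutPlane hz),
    (hasSum_pochRatio_one hz).tsum_eq, eulerIntegral, ← intervalIntegral.integral_const_mul]
  have h2 := Complex.slitPlane_ne_zero (mem_cutPlane_of_norm_lt_one hz)
  congr 1
  ext t
  have h3 : 1 - z / (z - 1) * ((t ^ 2 : ℝ) : ℂ) = (1 - z * ((1 - t ^ 2 : ℝ) : ℂ)) / (1 - z) := by
    have : z - 1 ≠ 0 := fun h => h2 (by linear_combination -h)
    push_cast
    field_simp
    ring
  rw [h3, inv_div, div_eq_mul_inv]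

theorem tsum_pochRatio_one_sq {x : ℝ} (hx0 : x ≠ 0) (hx : |x| < 1) :
    ∑' k, pochRatio 1 k * ((x : ℂ) ^ 2) ^ k = (Real.arcsin x / (x * √(1 - x ^ 2)) : ℝ) := by
  have hx2 : x ^ 2 < 1 := (sq_lt_one_iff_abs_lt_one x).2 hx
  have hs : 0 < √(1 - x ^ 2) := Real.sqrt_pos.2 (by linarith)
  have hs2 : √(1 - x ^ 2) ^ 2 = 1 - x ^ 2 := Real.sq_sqrt (by linarith)
  have hz : ‖(x : ℂ) ^ 2‖ < 1 := by
    rw [norm_pow, Complex.norm_real, Real.norm_eq_abs, sq_abs]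
    exact hx2
  have hd : ∀ t ∈ Set.uIcc (0 : ℝ) 1,
      HasDerivAt (fun t : ℝ => Real.arctan (x * t / √(1 - x ^ 2)) / (x * √(1 - x ^ 2)))
        (1 - x ^ 2 * (1 - t ^ 2))⁻¹ t := by
    intro t _
    have h := ((((hasDerivAt_id t).const_mul x).div_const √(1 - x ^ 2)).arctan).div_const
      (x * √(1 - x ^ 2))
    refine h.congr_deriv ?_
    have h1 : 1 - x ^ 2 * (1 - t ^ 2) = √(1 - x ^ 2) ^ 2 + (x * t) ^ 2 := by rw [hs2]; ring
    have h2 : 0 < √(1 - x ^ 2) ^ 2 + (x * t) ^ 2 := by positivity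
    rw [h1]
    -- The denominator is now `(1 - x²) + (x t)²`, the arctangent form.
    simp only [id]
    field_simp
  have hpos : ∀ t : ℝ, 1 - x ^ 2 * (1 - t ^ 2) ≠ 0 := fun t => by
    have : 0 ≤ x ^ 2 * t ^ 2 := by positivity
    nlinarith
  have h := intervalIntegral.integral_eq_sub_of_hasDerivAt hd
    (Continuous.intervalIntegrable (Continuous.inv₀ (by fun_prop) hpos) _ _)
  rw [(hasSum_pochRatio_one hz).tsum_eq]
  have h' : ∀ t : ℝ, (1 - (x : ℂ) ^ 2 * ((1 - t ^ 2 : ℝ) : ℂ))⁻¹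
      = (((1 - x ^ 2 * (1 - t ^ 2))⁻¹ : ℝ) : ℂ) := fun t => by push_cast; rfl
  simp only [h']
  rw [intervalIntegral.integral_ofReal, h, Real.arcsin_eq_arctan (abs_lt.1 hx)]
  simp

/-! ### The product identity for formal power series -/

open PowerSeries in
theorem PowerSeries.coeff_X_mul_derivative (f : ℂ⟦X⟧) (k : ℕ) :
    coeff k (X * d⁄dX ℂ f) = k * coeff k f := by
  cases k with
  | zero => simp
  | succ k =>
    rw [coeff_succ_X_mul, coeff_derivative]
    push_cast
    ring

open PowerSeries in
theorem PowerSeries.coeff_natCast_mul (m : ℕ) (f : ℂ⟦X⟧) (k : ℕ) :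
    coeff k ((m : ℂ⟦X⟧) * f) = m * coeff k f := by
  rw [← map_natCast (C (R := ℂ)), coeff_C_mul]

open PowerSeries in
-- The recurrence `pochRatio_succ_mul` as a first-order differential equation; the constant `2m - 1`
-- accounts for the initial coefficient.
theorem pochRatio_mk_derivative (m : ℕ) :
    (2 * (m : ℂ⟦X⟧) - 1) * mk (pochRatio m) + 2 * (X * d⁄dX ℂ (mk (pochRatio m)))
      = (2 * (m : ℂ⟦X⟧) - 1)
        + 2 * (X * ((m : ℂ⟦X⟧) * mk (pochRatio m) + X * d⁄dX ℂ (mk (pochRatio m)))) := by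
  have e : (2 * (m : ℂ⟦X⟧) - 1) = C (2 * (m : ℂ) - 1) := by
    rw [map_sub, map_mul, map_ofNat, map_natCast, map_one]
  have e2 : (2 : ℂ⟦X⟧) = C (2 : ℂ) := (map_ofNat C 2).symm
  rw [e, e2]
  ext k
  cases k with
  | zero => simp [pochRatio_zero]
  | succ k =>
    have h := pochRatio_succ_mul m k
    simp only [map_add, coeff_C_mul, coeff_X_mul_derivative, coeff_succ_X_mul, coeff_mk,
      coeff_natCast_mul, coeff_derivative, coeff_C, Nat.succ_ne_zero, if_false]
    linear_combination 2 * h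

open PowerSeries in
theorem weighted_mk_derivative {n : ℕ} (hn : 1 ≤ n) (r : ℕ → ℂ) :
    (n : ℂ⟦X⟧) * mk (fun k => r k * (n / ((n : ℂ) + k)))
      + X * d⁄dX ℂ (mk fun k => r k * (n / ((n : ℂ) + k))) = (n : ℂ⟦X⟧) * mk r := by
  ext k
  have h1 : (n : ℂ) + k ≠ 0 := by exact_mod_cast (by omega : n + k ≠ 0)
  simp only [map_add, coeff_X_mul_derivative, coeff_mk, coeff_natCast_mul]
  field_simp

open PowerSeries in
theorem pochRatio_mk_product {n : ℕ} (hn : 1 ≤ n) :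
    (2 * (n : ℂ⟦X⟧) - 1) * mk (fun k => pochRatio 1 k * (n / ((n : ℂ) + k)))
        + mk (fun k => pochRatio n k * (n / ((n : ℂ) + k)))
      = 2 * (n : ℂ⟦X⟧) * ((1 - X) * (mk (pochRatio 1) * mk (pochRatio n))) := by
  have hA := weighted_mk_derivative hn (pochRatio 1)
  have hB := weighted_mk_derivative hn (pochRatio n)
  have hG := pochRatio_mk_derivative 1
  have hL := pochRatio_mk_derivative n
  set A := mk (fun k => pochRatio 1 k * (n / ((n : ℂ) + k)))
  set B := mk (fun k => pochRatio n k * (n / ((n : ℂ) + k)))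
  set G := mk (pochRatio 1)
  set L := mk (pochRatio n)
  rw [← sub_eq_zero]
  set Q := (2 * (n : ℂ⟦X⟧) - 1) * A + B - 2 * (n : ℂ⟦X⟧) * ((1 - X) * (G * L)) with hQ
  have h2 : d⁄dX ℂ (2 : ℂ⟦X⟧) = 0 := by
    simpa using (d⁄dX ℂ).map_natCast (A := ℂ⟦X⟧) 2
  -- With `X(1 - X)G'` and `X(1 - X)L'` replaced through `hG` and `hL`, all `G * L` terms cancel,
  -- and what remains matches `hA` and `hB`.
  have hode : (n : ℂ⟦X⟧) * Q + X * d⁄dX ℂ Q = 0 := by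
    have hd : d⁄dX ℂ Q = (2 * (n : ℂ⟦X⟧) - 1) * d⁄dX ℂ A + d⁄dX ℂ B
        - 2 * (n : ℂ⟦X⟧) * ((1 - X) * (G * d⁄dX ℂ L + L * d⁄dX ℂ G) - G * L) := by
      rw [hQ]
      simp only [map_add, map_sub, Derivation.leibniz, smul_eq_mul, Derivation.map_natCast, h2,
        Derivation.map_one_eq_zero, derivative_X]
      ring
    rw [hd, hQ]
    push_cast at hG
    linear_combination (2 * (n : ℂ⟦X⟧) - 1) * hA + hB - (n : ℂ⟦X⟧) * L * hG - (n : ℂ⟦X⟧) * G * hL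
  ext k
  have h := congrArg (coeff k) hode
  rw [map_add, coeff_natCast_mul, coeff_X_mul_derivative, ← add_mul, map_zero] at h
  have h1 : (n : ℂ) + k ≠ 0 := by exact_mod_cast (by omega : n + k ≠ 0)
  rw [map_zero]
  exact (mul_eq_zero.1 h).resolve_left h1

/-! ### Evaluation in the unit disc -/

open PowerSeries in
theorem PowerSeries.tsum_coeff_mul {f g : ℂ⟦X⟧} {z : ℂ}
    (hf : Summable fun k => ‖coeff k f * z ^ k‖) (hg : Summable fun k => ‖coeff k g * z ^ k‖) :
    (Summable fun k => ‖coeff k (f * g) * z ^ k‖) ∧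
      ∑' k, coeff k (f * g) * z ^ k = (∑' k, coeff k f * z ^ k) * ∑' k, coeff k g * z ^ k := by
  have h : ∀ k, ∑ p ∈ Finset.HasAntidiagonal.antidiagonal k, coeff p.1 f * z ^ p.1 * (coeff p.2 g * z ^ p.2)
      = coeff k (f * g) * z ^ k := by
    intro k
    rw [coeff_mul, Finset.sum_mul]
    refine Finset.sum_congr rfl fun p hp => ?_
    rw [← Finset.HasAntidiagonal.mem_antidiagonal.1 hp, pow_add]
    ring
  constructor
  · simpa only [h] using summable_norm_sum_mul_antidiagonal_of_summable_norm hf hg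
  · rw [tsum_mul_tsum_eq_tsum_sum_antidiagonal_of_summable_norm hf hg]
    simp only [h]

theorem summable_norm_mul_pow {r : ℕ → ℂ} (hr : ∀ k, ‖r k‖ ≤ 1) {z : ℂ} (hz : ‖z‖ < 1) :
    Summable fun k => ‖r k * z ^ k‖ := by
  refine Summable.of_nonneg_of_le (fun _ => norm_nonneg _) (fun k => ?_)
    (summable_geometric_of_lt_one (norm_nonneg z) hz)
  rw [norm_mul, norm_pow]
  exact mul_le_of_le_one_left (by positivity) (hr k)

theorem norm_pochRatio_weighted_le_one {n : ℕ} (hn : 1 ≤ n) (p k : ℕ) :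
    ‖pochRatio p k * (n / ((n : ℂ) + k))‖ ≤ 1 := by
  rw [norm_mul]
  refine mul_le_one₀ (norm_pochRatio_le_one p k) (norm_nonneg _) ?_
  have h : ((n : ℂ) / ((n : ℂ) + k)) = ((n / ((n : ℝ) + k) : ℝ) : ℂ) := by push_cast; rfl
  have hn' : (0 : ℝ) < n := by exact_mod_cast hn
  rw [h, Complex.norm_real, Real.norm_of_nonneg (by positivity), div_le_one (by positivity)]
  have : (0 : ℝ) ≤ k := k.cast_nonneg
  linarith

open PowerSeries in
theorem tsum_pochRatio_product {n : ℕ} (hn : 1 ≤ n) {z : ℂ} (hz : ‖z‖ < 1) :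
    (2 * (n : ℂ) - 1) * ∑' k, pochRatio 1 k * (n / ((n : ℂ) + k)) * z ^ k
        + ∑' k, pochRatio n k * (n / ((n : ℂ) + k)) * z ^ k
      = 2 * (n : ℂ) * ((1 - z) * ∑' k, pochRatio 1 k * z ^ k) *
        ∑' k, pochRatio n k * z ^ k := by
  have hA := summable_norm_mul_pow (norm_pochRatio_weighted_le_one hn 1) hz
  have hB := summable_norm_mul_pow (norm_pochRatio_weighted_le_one hn n) hz
  have hG : Summable fun k => ‖coeff k (mk (pochRatio 1)) * z ^ k‖ := by
    simpa only [coeff_mk] using summable_norm_mul_pow (norm_pochRatio_le_one 1) hz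
  have hL : Summable fun k => ‖coeff k (mk (pochRatio n)) * z ^ k‖ := by
    simpa only [coeff_mk] using summable_norm_mul_pow (norm_pochRatio_le_one n) hz
  have hX : HasSum (fun k => coeff k (1 - X : ℂ⟦X⟧) * z ^ k) (1 - z) := by
    have h0 : HasSum (fun k => coeff k (1 : ℂ⟦X⟧) * z ^ k) 1 := by
      simpa using hasSum_single (f := fun k => coeff k (1 : ℂ⟦X⟧) * z ^ k) 0
        (fun k hk => by simp [coeff_one, hk])
    have h1 : HasSum (fun k => coeff k (X : ℂ⟦X⟧) * z ^ k) z := by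
      simpa using hasSum_single (f := fun k => coeff k (X : ℂ⟦X⟧) * z ^ k) 1
        (fun k hk => by simp [coeff_X, hk])
    simpa only [map_sub, sub_mul] using h0.sub h1
  obtain ⟨hGL, eGL⟩ := PowerSeries.tsum_coeff_mul hG hL
  obtain ⟨-, eP⟩ := PowerSeries.tsum_coeff_mul hX.summable.norm hGL
  have hcoeff : ∀ k, (2 * (n : ℂ) - 1) * (pochRatio 1 k * (n / ((n : ℂ) + k)) * z ^ k)
        + pochRatio n k * (n / ((n : ℂ) + k)) * z ^ k
      = 2 * (n : ℂ) * (coeff k ((1 - X) * (mk (pochRatio 1) * mk (pochRatio n))) * z ^ k) := by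
    intro k
    have e : (2 * (n : ℂ⟦X⟧) - 1) = C (2 * (n : ℂ) - 1) := by
      rw [map_sub, map_mul, map_ofNat, map_natCast, map_one]
    have e2 : (2 * (n : ℂ⟦X⟧)) = C (2 * (n : ℂ)) := by rw [map_mul, map_ofNat, map_natCast]
    have h := congrArg (coeff k) (pochRatio_mk_product hn)
    rw [e, e2] at h
    simp only [map_add, coeff_C_mul, coeff_mk] at h
    linear_combination z ^ k * h
  rw [← tsum_mul_left, ← (hA.of_norm.mul_left _).tsum_add hB.of_norm]
  simp only [hcoeff]
  rw [tsum_mul_left, eP, eGL, hX.tsum_eq]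
  simp only [coeff_mk]
  ring

/-- In the unit disc, the hypergeometric identity is an identity between power series. -/
theorem hypProductIdentity_iff {n : ℕ} (hn : 1 ≤ n) {z : ℂ} (hz : ‖z‖ < 1) :
    HypProductIdentity n z ↔
      (2 * (n : ℂ) - 1) * ∑' k, pochRatio 1 k * (n / ((n : ℂ) + k)) * z ^ k
          + ∑' k, pochRatio n k * (n / ((n : ℂ) + k)) * z ^ k
        = 2 * (n : ℂ) * ((1 - z) * ∑' k, pochRatio 1 k * z ^ k) *
          ∑' k, pochRatio n k * z ^ k := by
  rw [HypProductIdentity, hypPFQ_half_one_div_sub_one hz, hypPFQ_eq_tsum _ _ hz,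
    hypPFQ_eq_tsum _ _ hz, hypPFQ_eq_tsum _ _ hz]
  simp only [hypTerm_one_one hn, hypTerm_one_nat_nat hn, hypTerm_one_nat]

theorem hypProductIdentity {n : ℕ} (hn : 1 ≤ n) {z : ℂ} (hz : ‖z‖ < 1) :
    HypProductIdentity n z :=
  (hypProductIdentity_iff hn hz).2 (tsum_pochRatio_product hn hz)

/-! ### Tails of the series and the equivalence with the arcsine identity -/

theorem pochRatio_one_ne_zero (k : ℕ) : pochRatio 1 k ≠ 0 := by
  rw [pochRatio_one_eq]
  have h2 : (2 * (k : ℂ) + 1) ≠ 0 := by exact_mod_cast Nat.succ_ne_zero (2 * k)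
  have h4 : ((2 * k).choose k : ℂ) ≠ 0 := by exact_mod_cast k.centralBinom_ne_zero
  exact div_ne_zero (pow_ne_zero _ (by norm_num)) (mul_ne_zero h4 h2)

/-- By `pochRatio_add`, the series with parameter `p + 1` is a rescaled tail of the one with
parameter `1`. -/
theorem tsum_pochRatio_shift (p : ℕ) {z : ℂ} (hz : ‖z‖ < 1) :
    pochRatio 1 p * z ^ p * ∑' k, pochRatio (p + 1) k * z ^ k
      = ∑' k, pochRatio 1 k * z ^ k - ∑ j ∈ Finset.range p, pochRatio 1 j * z ^ j := by
  rw [eq_sub_iff_add_eq',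
    ← (summable_norm_mul_pow (norm_pochRatio_le_one 1) hz).of_norm.sum_add_tsum_nat_add p,
    ← tsum_mul_left]
  congr 1
  refine tsum_congr fun k => ?_
  rw [add_comm k p, pochRatio_add, add_comm 1 p]
  ring

theorem tsum_pochRatio_weighted_shift (p : ℕ) {z : ℂ} (hz : ‖z‖ < 1) :
    pochRatio 1 p * z ^ p * ∑' k, pochRatio (p + 1) k *
        (((p + 1 : ℕ) : ℂ) / (((p + 1 : ℕ) : ℂ) + k)) * z ^ k
      = ((p + 1 : ℕ) : ℂ) * (∑' k, pochRatio 1 k * (((1 : ℕ) : ℂ) / (((1 : ℕ) : ℂ) + k)) * z ^ k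
        - ∑ j ∈ Finset.range p, pochRatio 1 j * (((1 : ℕ) : ℂ) / (((1 : ℕ) : ℂ) + j)) * z ^ j) := by
  have hs := (summable_norm_mul_pow (norm_pochRatio_weighted_le_one le_rfl 1) hz).of_norm
  rw [← hs.sum_add_tsum_nat_add p, add_sub_cancel_left, ← tsum_mul_left, ← tsum_mul_left]
  refine tsum_congr fun k => ?_
  rw [add_comm k p, pochRatio_add, add_comm 1 p]
  push_cast
  ring

theorem tsum_pochRatio_one_weighted {z : ℂ} (hz : ‖z‖ < 1) :
    ∑' k, pochRatio 1 k * (((1 : ℕ) : ℂ) / (((1 : ℕ) : ℂ) + k)) * z ^ k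
      = (1 - z) * (∑' k, pochRatio 1 k * z ^ k) ^ 2 := by
  -- For `n = 1` the two weighted series coincide, so the product identity gives twice the claim.
  have h := tsum_pochRatio_product le_rfl hz
  push_cast at h ⊢
  linear_combination (1 / 2 : ℂ) * h

/-- The right-hand side of the arcsine identity of index `2 * p`. -/
noncomputable def arcsinSqRHS (p : ℕ) (x : ℝ) : ℝ :=
  ((2 * p).choose p : ℝ) / (2 * x) ^ (2 * p) *
    (Real.arcsin x ^ 2
      - √(1 - x ^ 2) * Real.arcsin x *
        ∑ j ∈ Finset.range p, (2 * x) ^ (2 * j + 1) / (((2 * j).choose j : ℝ) * (2 * (j : ℝ) + 1))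
      + 1 / 2 * ∑ j ∈ Finset.Icc 1 p,
          (2 * x) ^ (2 * j) / (((2 * j).choose j : ℝ) * (j : ℝ) ^ 2))

theorem Finset.sum_Icc_one_eq_sum_range (f : ℕ → ℝ) (p : ℕ) :
    ∑ j ∈ Finset.Icc 1 p, f j = ∑ j ∈ Finset.range p, f (j + 1) := by
  induction p with
  | zero => simp
  | succ p ih => rw [Finset.sum_Icc_succ_top (by omega), ih, Finset.sum_range_succ]

theorem pochRatio_mul_arcsinSqRHS (p : ℕ) {x : ℝ} (hx0 : x ≠ 0) :
    pochRatio 1 p * ((x : ℂ) ^ 2) ^ p * (2 * p + 1) * (arcsinSqRHS p x : ℂ)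
      = (Real.arcsin x : ℂ) ^ 2
        - 2 * x * (√(1 - x ^ 2) : ℝ) * (Real.arcsin x : ℂ) *
            ∑ j ∈ Finset.range p, pochRatio 1 j * ((x : ℂ) ^ 2) ^ j
        + x ^ 2 * ∑ j ∈ Finset.range p,
            pochRatio 1 j * (((1 : ℕ) : ℂ) / (((1 : ℕ) : ℂ) + j)) * ((x : ℂ) ^ 2) ^ j := by
  have hxc : (x : ℂ) ≠ 0 := by exact_mod_cast hx0
  have h2 : (2 * (p : ℂ) + 1) ≠ 0 := by exact_mod_cast Nat.succ_ne_zero (2 * p)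
  have h4 : ((2 * p).choose p : ℂ) ≠ 0 := by exact_mod_cast p.centralBinom_ne_zero
  -- The factor on the left of the goal is exactly the inverse of the prefactor in `arcsinSqRHS`.
  have hfac : pochRatio 1 p * ((x : ℂ) ^ 2) ^ p * (2 * p + 1) *
      (((2 * p).choose p : ℂ) / (2 * x) ^ (2 * p)) = 1 := by
    have hp : (2 * (x : ℂ)) ^ (2 * p) = 4 ^ p * ((x : ℂ) ^ 2) ^ p := by
      rw [pow_mul, ← mul_pow]
      congr 1
      ring
    have h5 : (4 : ℂ) ^ p ≠ 0 := pow_ne_zero _ (by norm_num)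
    have h6 : ((x : ℂ) ^ 2) ^ p ≠ 0 := pow_ne_zero _ (pow_ne_zero _ hxc)
    rw [pochRatio_one_eq, hp]
    field_simp
  have hS : ∑ j ∈ Finset.range p, (2 * (x : ℂ)) ^ (2 * j + 1) /
        (((2 * j).choose j : ℂ) * (2 * (j : ℂ) + 1))
      = 2 * x * ∑ j ∈ Finset.range p, pochRatio 1 j * ((x : ℂ) ^ 2) ^ j := by
    rw [Finset.mul_sum]
    refine Finset.sum_congr rfl fun j _ => ?_
    rw [pochRatio_one_eq, pow_succ, pow_mul, mul_pow, mul_pow]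
    norm_num
    ring_nf
  have hT : ∑ j ∈ Finset.range p, (2 * (x : ℂ)) ^ (2 * (j + 1)) /
        (((2 * (j + 1)).choose (j + 1) : ℂ) * ((j : ℂ) + 1) ^ 2)
      = 2 * (x ^ 2 * ∑ j ∈ Finset.range p,
            pochRatio 1 j * (((1 : ℕ) : ℂ) / (((1 : ℕ) : ℂ) + j)) * ((x : ℂ) ^ 2) ^ j) := by
    rw [Finset.mul_sum, Finset.mul_sum]
    refine Finset.sum_congr rfl fun j _ => ?_
    have h3 : ((j : ℂ) + 1) ≠ 0 := Nat.cast_add_one_ne_zero j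
    have h5 : ((2 * (j + 1)).choose (j + 1) : ℂ) ≠ 0 := by
      exact_mod_cast (j + 1).centralBinom_ne_zero
    rw [pochRatio_one_eq', pow_mul, mul_pow, mul_pow, Nat.cast_one, add_comm (1 : ℂ)]
    norm_num
    field_simp
    ring
  rw [arcsinSqRHS, Finset.sum_Icc_one_eq_sum_range]
  push_cast
  rw [hS, hT, ← mul_assoc, hfac]
  ring

theorem norm_ofReal_sq_lt_one {x : ℝ} (hx : |x| < 1) : ‖(x : ℂ) ^ 2‖ < 1 := by
  rw [norm_pow, Complex.norm_real, Real.norm_eq_abs, sq_abs]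
  exact (sq_lt_one_iff_abs_lt_one x).2 hx

/-- The closed form of all terms but the first in the hypergeometric identity at `x ^ 2`. -/
theorem arcsinSqRHS_add_tsum (p : ℕ) {x : ℝ} (hx0 : x ≠ 0) (hx : |x| < 1) :
    (2 * ((p + 1 : ℕ) : ℂ) - 1) * (((p + 1 : ℕ) : ℂ) / (x : ℂ) ^ 2 * arcsinSqRHS p x)
        + ∑' k, pochRatio (p + 1) k * (((p + 1 : ℕ) : ℂ) / (((p + 1 : ℕ) : ℂ) + k))
            * ((x : ℂ) ^ 2) ^ k
      = 2 * ((p + 1 : ℕ) : ℂ) * ((1 - (x : ℂ) ^ 2) * ∑' k, pochRatio 1 k * ((x : ℂ) ^ 2) ^ k) *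
        ∑' k, pochRatio (p + 1) k * ((x : ℂ) ^ 2) ^ k := by
  have hz := norm_ofReal_sq_lt_one hx
  have hxc : (x : ℂ) ≠ 0 := by exact_mod_cast hx0
  have hx2 : x ^ 2 < 1 := (sq_lt_one_iff_abs_lt_one x).2 hx
  have hs : √(1 - x ^ 2) ≠ 0 := (Real.sqrt_pos.2 (by linarith)).ne'
  have hsc : ((√(1 - x ^ 2) : ℝ) : ℂ) ≠ 0 := by exact_mod_cast hs
  have hs2 : ((√(1 - x ^ 2) : ℝ) : ℂ) ^ 2 = 1 - (x : ℂ) ^ 2 := by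
    exact_mod_cast Real.sq_sqrt (by linarith : (0 : ℝ) ≤ 1 - x ^ 2)
  have hT : pochRatio 1 p * ((x : ℂ) ^ 2) ^ p ≠ 0 :=
    mul_ne_zero (pochRatio_one_ne_zero p) (pow_ne_zero _ (pow_ne_zero _ hxc))
  have hR := pochRatio_mul_arcsinSqRHS p hx0
  have hL := tsum_pochRatio_shift p hz
  have hB := tsum_pochRatio_weighted_shift p hz
  rw [tsum_pochRatio_one_weighted hz] at hB
  rw [tsum_pochRatio_one_sq hx0 hx] at hL hB ⊢
  -- Scaling by the first term of the tail makes `hR`, `hL` and `hB` applicable; the partial sums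
  -- `S` and `W` then cancel.
  refine mul_left_cancel₀ hT ?_
  rw [← hs2] at hB ⊢
  push_cast at hB hL hR ⊢
  generalize (∑' k, pochRatio (p + 1) k * ((x : ℂ) ^ 2) ^ k) = L at *
  generalize (∑' k, pochRatio (p + 1) k * (((p : ℂ) + 1) / ((p : ℂ) + 1 + k)) * ((x : ℂ) ^ 2) ^ k)
    = B at *
  generalize (∑ j ∈ Finset.range p, pochRatio 1 j * ((x : ℂ) ^ 2) ^ j) = S at *
  generalize (∑ j ∈ Finset.range p, pochRatio 1 j * (1 / (1 + (j : ℂ))) * ((x : ℂ) ^ 2) ^ j)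
    = W at *
  generalize ((√(1 - x ^ 2) : ℝ) : ℂ) = s at *
  generalize (Real.arcsin x : ℂ) = a at *
  generalize pochRatio 1 p * ((x : ℂ) ^ 2) ^ p = T at *
  have e1 : s ^ 2 * (a / (x * s)) = s * a / x := by field_simp
  have e2 : s ^ 2 * (a / (x * s)) ^ 2 = a ^ 2 / x ^ 2 := by field_simp
  rw [e2] at hB
  rw [e1]
  have e3 : s * a / x * (a / (x * s)) = a ^ 2 / x ^ 2 := by field_simp
  have e4 : (x : ℂ) ^ 2 / x ^ 2 = 1 := div_self (pow_ne_zero 2 hxc)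
  have e5 : (x : ℂ) / x ^ 2 = 1 / x := by field_simp
  linear_combination ((p : ℂ) + 1) / x ^ 2 * hR + hB - 2 * ((p : ℂ) + 1) * (s * a / x) * hL
    - 2 * ((p : ℂ) + 1) * e3 + ((p : ℂ) + 1) * W * e4 - 2 * ((p : ℂ) + 1) * s * a * S * e5

theorem arcsinSqIdentity_iff_tsum (p : ℕ) {x : ℝ} (hx0 : x ≠ 0) (hx : |x| < 1) :
    ArcsinSqIdentity (2 * p) x ↔
      ∑' k, pochRatio 1 k * (((p + 1 : ℕ) : ℂ) / (((p + 1 : ℕ) : ℂ) + k)) * ((x : ℂ) ^ 2) ^ k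
        = ((p + 1 : ℕ) : ℂ) / (x : ℂ) ^ 2 * arcsinSqRHS p x := by
  have hz := norm_ofReal_sq_lt_one hx
  have hxc : (x : ℂ) ^ 2 ≠ 0 := pow_ne_zero 2 (by exact_mod_cast hx0)
  have hn : ((p + 1 : ℕ) : ℂ) ≠ 0 := Nat.cast_ne_zero.2 (Nat.succ_ne_zero p)
  have hsum := (summable_norm_mul_pow (norm_pochRatio_weighted_le_one (n := p + 1) (by omega) 1)
    hz).of_norm
  have hterm : ∀ k : ℕ, (((2 * x) ^ (2 * (k + 1)) / (((2 * (k + 1)).choose (k + 1) : ℝ) *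
        ((k : ℝ) + 1) * (2 * ((k : ℝ) + 1) + ((2 * p : ℕ) : ℝ))) : ℝ) : ℂ)
      = (((p + 1 : ℕ) : ℂ) / (x : ℂ) ^ 2)⁻¹ *
        (pochRatio 1 k * (((p + 1 : ℕ) : ℂ) / (((p + 1 : ℕ) : ℂ) + k)) * ((x : ℂ) ^ 2) ^ k) := by
    intro k
    have h3 : ((k : ℂ) + 1) ≠ 0 := Nat.cast_add_one_ne_zero k
    have h5 : ((2 * (k + 1)).choose (k + 1) : ℂ) ≠ 0 := by
      exact_mod_cast (k + 1).centralBinom_ne_zero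
    have h6 : (p : ℂ) + 1 + k ≠ 0 := by exact_mod_cast (by omega : p + 1 + k ≠ 0)
    have h7 : 2 * ((k : ℂ) + 1) + 2 * p = 2 * (p + 1 + k) := by ring
    rw [pochRatio_one_eq']
    push_cast at hn ⊢
    rw [h7, pow_mul, mul_pow, mul_pow]
    norm_num
    field_simp
    ring
  rw [ArcsinSqIdentity, Nat.mul_div_cancel_left p two_pos, ← arcsinSqRHS, ← Complex.hasSum_ofReal]
  simp only [hterm]
  have hc : ((p + 1 : ℕ) : ℂ) / (x : ℂ) ^ 2 ≠ 0 := div_ne_zero hn hxc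
  constructor
  · intro h
    have h' := h.mul_left (((p + 1 : ℕ) : ℂ) / (x : ℂ) ^ 2)
    simp only [mul_inv_cancel_left₀ hc] at h'
    exact h'.tsum_eq
  · intro h
    have h' := hsum.hasSum.mul_left (((p + 1 : ℕ) : ℂ) / (x : ℂ) ^ 2)⁻¹
    rwa [h, inv_mul_cancel_left₀ hc] at h'

theorem arcsinSqIdentity_iff_hypProductIdentity (p : ℕ) {x : ℝ} (hx0 : x ≠ 0) (hx : |x| < 1) :
    ArcsinSqIdentity (2 * p) x ↔ HypProductIdentity (p + 1) ((x : ℂ) ^ 2) := by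
  have hc : (2 * ((p + 1 : ℕ) : ℂ) - 1) ≠ 0 := by
    have h2 : (2 * (p : ℂ) + 1) ≠ 0 := by exact_mod_cast Nat.succ_ne_zero (2 * p)
    push_cast
    intro h
    exact h2 (by linear_combination h)
  -- Both right-hand sides are now the same expression, so `B` and the factor `2n - 1` cancel.
  rw [arcsinSqIdentity_iff_tsum p hx0 hx,
    hypProductIdentity_iff (by omega) (norm_ofReal_sq_lt_one hx), ← arcsinSqRHS_add_tsum p hx0 hx,
    add_left_inj, mul_right_inj' hc]

/-- For every `n ≥ 1`, the arcsine identity of even index `2(n-1)` at real `x`, `0 < |x| < 1`, is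
equivalent to the hypergeometric identity at `x²`; moreover the former holds for all such `x` and
the latter holds on the whole open unit disc. -/
theorem corollary8p3 (n : ℕ) (hn : 1 ≤ n) :
    (∀ x : ℝ, 0 < |x| → |x| < 1 →
      (ArcsinSqIdentity (2 * (n - 1)) x ↔ HypProductIdentity n ((x : ℂ) ^ 2))) ∧
    (∀ x : ℝ, 0 < |x| → |x| < 1 → ArcsinSqIdentity (2 * (n - 1)) x) ∧
    (∀ z : ℂ, ‖z‖ < 1 → HypProductIdentity n z) := by
  obtain ⟨p, rfl⟩ := Nat.exists_eq_add_of_le' hn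
  rw [Nat.add_sub_cancel]
  have hiff : ∀ x : ℝ, 0 < |x| → |x| < 1 →
      (ArcsinSqIdentity (2 * p) x ↔ HypProductIdentity (p + 1) ((x : ℂ) ^ 2)) :=
    fun x hx0 hx => arcsinSqIdentity_iff_hypProductIdentity p (abs_pos.1 hx0) hx
  exact ⟨hiff, fun x hx0 hx => (hiff x hx0 hx).2 (hypProductIdentity hn (norm_ofReal_sq_lt_one hx)),
    fun z hz => hypProductIdentity hn hz⟩
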